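/- For a functor $F\colon \mathbf{Set}\to\mathbf{Set}$, a \emph{relator} $R$ of $F$ assigns to every relation $r\subseteq X\times Y$ a relation $Rr\subseteq FX\times FY$, monotonically with respect to inclusion; relators are ordered pointwise ($R\le R'$ iff $Rr\subseteq R'r$ for every relation $r$). Write $s\cdot r=\{(x,z)\mid \exists y.\ x\mathrel{r}y\mathrel{s}z\}$ for composition of relations, $r^\circ$ for the converse of $r$, and $1_X$ for the identity relation on $X$, and identify functions with their graphs. A \emph{lax extension} of $F$ is a relator $R$ such that $Ff\subseteq R f$ and $(Ff)^\circ\subseteq R(f^\circ)$ for every function $f$, and $Rs\cdot Rr\subseteq R(s\cdot r)$ for all relations $r\subseteq X\times Y$, $s\subseteq Y\times Z$. It is \emph{normal} if $R1_X=1_{FX}$ for every set $X$. Let $(M,+,0)$ be a commutative monoid. The \emph{monoid-valued functor} $M^{(-)}$ sends a set $X$ to the set $M^{(X)}$ of maps $\mu\colon X\to M$ with $\mu(x)=0$ for all but finitely many $x\in X$, and a map $f\colon X\to Y$ to the map $M^{(f)}\colon M^{(X)}\to M^{(Y)}$ given by $M^{(f)}(\mu)(y)=\sum_{f(x)=y}\mu(x)$.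 \textbf{Corollary.} The functor $M^{(-)}$ has a greatest normal lax extension (that is, a greatest element of the class of its normal lax extensions) if and only if $M$ is positive, i.e. for all $m,n\in M$, $m+n=0$ implies $m=n=0$. -/

import Mathlib

universe u

open CategoryTheory
open scoped SetRel

/-- A relator of a set functor `F`: a monotone assignment sending each relation from `X` to `Y`
to a relation from `F X` to `F Y`. -/
@[ext]
structure Relator (F : Type u ⥤ Type u) where
  /-- The action on relations. -/
  onRel : ∀ {X Y : Type u}, SetRel X Y → SetRel (F.obj X) (F.obj Y)
  /-- The action is monotone with respect to inclusion of relations. -/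
  mono : ∀ {X Y : Type u} {r s : SetRel X Y}, r ⊆ s → onRel r ⊆ onRel s

namespace Relator

/-- Relators are ordered pointwise. -/
instance instPartialOrder (F : Type u ⥤ Type u) : PartialOrder (Relator F) where
  le R S := ∀ (X Y : Type u) (r : SetRel X Y), R.onRel r ⊆ S.onRel r
  le_refl _ _ _ _ := subset_rfl
  le_trans _ _ _ h₁ h₂ X Y r := (h₁ X Y r).trans (h₂ X Y r)
  le_antisymm R S h₁ h₂ := by
    ext X Y r p
    exact ⟨fun h => h₁ X Y r h, fun h => h₂ X Y r h⟩

/-- Lax extensions: relators that contain the graphs of the maps `F f` and their converses, and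
that preserve composition laxly. Here `r ○ s` relates `x` to `z` if `x` is related by `r` to some
`y` that is related by `s` to `z`. -/
structure IsLaxExtension {F : Type u ⥤ Type u} (R : Relator F) : Prop where
  graph_subset : ∀ {X Y : Type u} (f : X → Y),
    Function.graph (F.map (↾f)) ⊆ R.onRel (Function.graph f)
  graph_inv_subset : ∀ {X Y : Type u} (f : X → Y),
    (Function.graph (F.map (↾f))).inv ⊆ R.onRel (Function.graph f).inv
  comp_subset : ∀ {X Y Z : Type u} (r : SetRel X Y) (s : SetRel Y Z),
    R.onRel r ○ R.onRel s ⊆ R.onRel (r ○ s)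

/-- A relator is normal if it preserves identity relations. -/
def IsNormal {F : Type u ⥤ Type u} (R : Relator F) : Prop :=
  ∀ X : Type u, R.onRel (SetRel.id : SetRel X X) = SetRel.id

/-- `R` is the greatest normal lax extension of `F`. -/
def IsGreatestNormalLaxExtension {F : Type u ⥤ Type u} (R : Relator F) : Prop :=
  IsGreatest {S : Relator F | S.IsLaxExtension ∧ S.IsNormal} R

end Relator

/-- The monoid-valued functor of a commutative monoid `M`: it sends a set `X` to the set of
finitely supported maps from `X` to `M`, and a map `f` to the pushforward along `f`. -/
noncomputable def monoidValuedFunctor (M : Type u) [AddCommMonoid M] : Type u ⥤ Type u where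
  obj X := X →₀ M
  map f := ↾(fun μ => Finsupp.mapDomain f μ)
  map_id X := by
    ext μ : 3
    exact Finsupp.mapDomain_id (v := (μ : X →₀ M))
  map_comp f g := by
    ext μ : 3
    exact Finsupp.mapDomain_comp (f := ⇑f) (g := ⇑g) (v := (μ : _ →₀ M))

/-- The action on maps is given by summation over fibres. -/
theorem monoidValuedFunctor_map_apply {M : Type u} [AddCommMonoid M] {X Y : Type u} (f : X → Y)
    (μ : X →₀ M) (y : Y) [DecidableEq Y] :
    DFunLike.coe (F := Y →₀ M) ((monoidValuedFunctor M).map (↾f) μ) y = ∑ x ∈ μ.support with f x = y, μ x := by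
  change Finsupp.mapDomain f μ y = _
  simp [Finsupp.mapDomain, Finsupp.sum, Finsupp.single_apply, Finset.sum_ite]

/-- A commutative monoid is positive if `m + n = 0` implies `m = n = 0`. -/
def IsPositiveMonoid (M : Type u) [AddCommMonoid M] : Prop :=
  ∀ m n : M, m + n = 0 → m = 0 ∧ n = 0

/-! Normality makes a lax extension respect cospans both ways: it relates pairs identified by a
cospan over its pullback, and any cospan whose legs agree on `r` identifies pairs related over `r`.
If `m + n = 0`, a cospan with empty pullback relates a pair of masses `m`, `n` to `0` over the empty
relation; every cospan must then identify them, which forces `m = 0`. Conversely, restricting to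
supports and testing against all cospans bounds every normal lax extension by `SumsAgree`.
Positivity is needed only for this bound to contain graphs and their converses. -/

namespace Relator

variable {F : Type u ⥤ Type u} {L : Relator F}

/-- Lax extensions are stable under taking preimages of relations. -/
theorem IsLaxExtension.mem_preimage (hL : L.IsLaxExtension) {X Y X' Y' : Type u}
    {i : X' → X} {j : Y' → Y} {r : SetRel X Y} {a : F.obj X'} {b : F.obj Y'}
    (h : (F.map (↾i) a, F.map (↾j) b) ∈ L.onRel r) :
    (a, b) ∈ L.onRel {p : X' × Y' | (i p.1, j p.2) ∈ r} := by
  have h₁ : (a, F.map (↾i) a) ∈ L.onRel (Function.graph i) := hL.graph_subset i rfl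
  have h₂ : (F.map (↾j) b, b) ∈ L.onRel (Function.graph j).inv := hL.graph_inv_subset j rfl
  refine L.mono ?_ (hL.comp_subset _ _ ⟨_, hL.comp_subset _ _ ⟨_, h₁, h⟩, h₂⟩)
  rintro ⟨x, y⟩ ⟨_, ⟨_, rfl, hr⟩, (hy : j y = _)⟩
  subst hy
  exact hr

/-- Lax extensions are stable under taking images of relations. -/
theorem IsLaxExtension.mem_image (hL : L.IsLaxExtension) {X Y Z W : Type u}
    {f : X → Z} {g : Y → W} {r : SetRel X Y} {s : SetRel Z W} {a : F.obj X} {b : F.obj Y}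
    (hr : ∀ x y, (x, y) ∈ r → (f x, g y) ∈ s) (h : (a, b) ∈ L.onRel r) :
    (F.map (↾f) a, F.map (↾g) b) ∈ L.onRel s := by
  have h₁ : (F.map (↾f) a, a) ∈ L.onRel (Function.graph f).inv := hL.graph_inv_subset f rfl
  have h₂ : (b, F.map (↾g) b) ∈ L.onRel (Function.graph g) := hL.graph_subset g rfl
  refine L.mono ?_ (hL.comp_subset _ _ ⟨_, hL.comp_subset _ _ ⟨_, h₁, h⟩, h₂⟩)
  rintro ⟨x, y⟩ ⟨_, ⟨x', (hx : f x' = x), hxy⟩, rfl⟩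
  subst hx
  exact hr _ _ hxy

/-- A normal lax extension maps a relation contained in the kernel of a cospan into the kernel of
the image of that cospan. -/
theorem IsLaxExtension.map_eq_of_mem (hL : L.IsLaxExtension) (hN : L.IsNormal) {X Y Z : Type u}
    {f : X → Z} {g : Y → Z} {r : SetRel X Y} {a : F.obj X} {b : F.obj Y}
    (hr : ∀ x y, (x, y) ∈ r → f x = g y) (h : (a, b) ∈ L.onRel r) :
    F.map (↾f) a = F.map (↾g) b := by
  have := hL.mem_image (f := f) (g := g) (s := SetRel.id) hr h
  rw [hN] at this
  exact this

/-- A normal lax extension of `F` relates all pairs identified by the image of a cospan. -/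
theorem IsLaxExtension.mem_of_map_eq (hL : L.IsLaxExtension) (hN : L.IsNormal) {X Y Z : Type u}
    {f : X → Z} {g : Y → Z} {a : F.obj X} {b : F.obj Y}
    (h : F.map (↾f) a = F.map (↾g) b) :
    (a, b) ∈ L.onRel {p : X × Y | f p.1 = g p.2} := by
  refine hL.mem_preimage (r := SetRel.id) ?_
  rw [hN]
  exact h

end Relator

section MonoidValued

variable {M : Type u} [AddCommMonoid M]

/-- If the functor of `M` has a normal lax extension, then `M` is positive. -/
theorem isPositiveMonoid_of_isNormal {L : Relator (monoidValuedFunctor M)}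
    (hL : L.IsLaxExtension) (hN : L.IsNormal) : IsPositiveMonoid M := by
  have key : ∀ m n : M, m + n = 0 → m = 0 := by
    intro m n hmn
    let μ : ULift.{u} Bool →₀ M := Finsupp.single ⟨true⟩ m + Finsupp.single ⟨false⟩ n
    let ν : PUnit.{u + 1} →₀ M := 0
    have h : Finsupp.mapDomain (fun _ => (⟨true⟩ : ULift.{u} Bool)) μ =
        Finsupp.mapDomain (fun _ => ⟨false⟩) ν := by
      simp only [μ, ν, Finsupp.mapDomain_add, Finsupp.mapDomain_single, Finsupp.mapDomain_zero]
      rw [← Finsupp.single_add, hmn, Finsupp.single_zero]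
    -- The legs are constant with distinct values, so the relation obtained is empty and the next
    -- cospan is unconstrained.
    have hmem := hL.mem_of_map_eq hN (f := fun _ => (⟨true⟩ : ULift.{u} Bool))
      (g := fun _ => ⟨false⟩) (a := μ) (b := ν) h
    have h' : Finsupp.mapDomain (some : ULift.{u} Bool → _) μ =
        Finsupp.mapDomain (fun _ => none) ν :=
      hL.map_eq_of_mem hN (g := fun _ => none) (fun x y hxy => by simp at hxy) hmem
    have h0 := DFunLike.congr_fun h' (some ⟨true⟩)
    simpa [μ, ν, Finsupp.mapDomain_add, Finsupp.mapDomain_single, Finsupp.single_apply] using h0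
  exact fun m n h => ⟨key m n h, key n m (by rwa [add_comm])⟩

theorem IsPositiveMonoid.sum_ne_zero (hM : IsPositiveMonoid M) {ι : Type*} {s : Finset ι}
    {f : ι → M} {i : ι} (hi : i ∈ s) (hf : f i ≠ 0) : ∑ j ∈ s, f j ≠ 0 := by
  classical
  rw [← Finset.add_sum_erase s f hi]
  exact fun h => hf (hM _ _ h).1

theorem IsPositiveMonoid.mapDomain_apply_ne_zero (hM : IsPositiveMonoid M) {X Y : Type*}
    (k : X → Y) {μ : X →₀ M} {x : X} (hx : μ x ≠ 0) : Finsupp.mapDomain k μ (k x) ≠ 0 := by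
  classical
  rw [Finsupp.mapDomain, Finsupp.sum_apply]
  exact hM.sum_ne_zero (i := x) (Finsupp.mem_support_iff.2 hx) (by simpa using hx)

/-- Two finitely supported maps are related if every cospan that identifies related elements of
their supports also identifies their pushforwards. Equivalently, they have the same sums over the
connected components of the relation restricted to the supports. -/
def SumsAgree {X Y : Type u} (r : SetRel X Y) (μ : X →₀ M) (ν : Y →₀ M) : Prop :=
  ∀ (Z : Type u) (f : X → Z) (g : Y → Z),
    (∀ x y, μ x ≠ 0 → ν y ≠ 0 → (x, y) ∈ r → f x = g y) →
      Finsupp.mapDomain f μ = Finsupp.mapDomain g ν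

namespace SumsAgree

variable {X Y Z : Type u} {r : SetRel X Y} {s : SetRel Y Z} {μ : X →₀ M} {ν : Y →₀ M} {ρ : Z →₀ M}

theorem symm (h : SumsAgree r μ ν) : SumsAgree r.inv ν μ :=
  fun W f g hfg => (h W g f fun x y hx hy hxy => (hfg y x hy hx hxy).symm).symm

/-- Otherwise a cospan isolating `y` from all other points is admissible, and comparing coefficients
at `some y` gives `ν y = 0`. -/
theorem exists_left (h : SumsAgree r μ ν) {y : Y} (hy : ν y ≠ 0) :
    ∃ x, μ x ≠ 0 ∧ (x, y) ∈ r := by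
  classical
  by_contra! hne
  have h' := h (Option Y) (fun _ => none) (fun y' => if y' = y then some y else none) (by
    intro x y' hx _ hxy
    rw [if_neg]
    rintro rfl
    exact hne x hx hxy)
  have h0 := DFunLike.congr_fun h' (some y)
  rw [Finsupp.mapDomain, Finsupp.mapDomain, Finsupp.sum_apply, Finsupp.sum_apply] at h0
  have e : ∀ (y' : Y) (m : M),
      Finsupp.single (if y' = y then some y else none) m (some y) = if y' = y then m else 0 := by
    intro y' m
    split_ifs <;> simp
  simp only [e] at h0
  simp [Finsupp.sum] at h0
  exact hy (h0 hy).symm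

theorem exists_right (h : SumsAgree r μ ν) {x : X} (hx : μ x ≠ 0) :
    ∃ y, ν y ≠ 0 ∧ (x, y) ∈ r :=
  h.symm.exists_left hx

theorem comp (h₁ : SumsAgree r μ ν) (h₂ : SumsAgree s ν ρ) : SumsAgree (r ○ s) μ ρ := by
  classical
  intro W f g hfg
  by_cases hν : ∃ y, ν y ≠ 0
  · obtain ⟨y₀, hy₀⟩ := hν
    obtain ⟨x₀, -, -⟩ := h₁.exists_left hy₀
    have : Nonempty X := ⟨x₀⟩
    -- The leg `f ∘ k` on `Y` mediates between `f` and `g`: if `y` in the support of `ν` is related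
    -- to `z` in that of `ρ`, all its neighbours in the support of `μ` have `f`-value `g z`.
    choose! k hk using fun (y : Y) (hy : ν y ≠ 0) => h₁.exists_left hy
    refine (h₁ W f (f ∘ k) fun x y hx hy hxy => ?_).trans
      (h₂ W (f ∘ k) g fun y z hy hz hyz => ?_)
    · obtain ⟨z, hz, hyz⟩ := h₂.exists_right hy
      exact (hfg x z hx hz ⟨y, hxy, hyz⟩).trans
        (hfg (k y) z (hk y hy).1 hz ⟨y, (hk y hy).2, hyz⟩).symm
    · exact hfg (k y) z (hk y hy).1 hz ⟨y, (hk y hy).2, hyz⟩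
  · have hμ : μ = 0 := by
      ext x
      by_contra hx
      exact hν ((h₁.exists_right hx).imp fun _ => And.left)
    have hρ : ρ = 0 := by
      ext z
      by_contra hz
      exact hν ((h₂.exists_left hz).imp fun _ => And.left)
    simp [hμ, hρ]

/-- Without cancellation, `k` maps the support of `μ` into that of its pushforward, so `f` and `g ∘
k` agree on the support of `μ`. -/
theorem graph (hM : IsPositiveMonoid M) (k : X → Y) (μ : X →₀ M) :
    SumsAgree (Function.graph k) μ (Finsupp.mapDomain k μ) := by
  intro W f g hfg
  rw [← Finsupp.mapDomain_comp]
  refine Finsupp.mapDomain_congr fun x hx => ?_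
  have hx' := Finsupp.mem_support_iff.1 hx
  exact hfg x (k x) hx' (hM.mapDomain_apply_ne_zero k hx') rfl

end SumsAgree

/-- The relator of the monoid-valued functor given by `SumsAgree`. -/
def sumsAgreeRelator (M : Type u) [AddCommMonoid M] : Relator (monoidValuedFunctor M) where
  onRel {X Y} r := {p : (X →₀ M) × (Y →₀ M) | SumsAgree r p.1 p.2}
  mono hrs _ hp Z f g hfg := hp Z f g fun x y hx hy hxy => hfg x y hx hy (hrs hxy)

theorem sumsAgreeRelator_isLaxExtension (hM : IsPositiveMonoid M) :
    (sumsAgreeRelator M).IsLaxExtension where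
  graph_subset f := by
    rintro ⟨μ, _⟩ rfl
    exact SumsAgree.graph hM f μ
  graph_inv_subset f := by
    rintro ⟨ν, μ⟩ (hν : (monoidValuedFunctor M).map (↾f) μ = ν)
    subst hν
    exact (SumsAgree.graph hM f μ).symm
  comp_subset r s := by
    rintro ⟨μ, ρ⟩ ⟨ν, h₁, h₂⟩
    exact SumsAgree.comp h₁ h₂

theorem sumsAgreeRelator_isNormal : (sumsAgreeRelator M).IsNormal := by
  intro X
  ext ⟨μ, ν⟩
  constructor
  · intro h
    have h' := h X id id fun _ _ _ _ hxy => hxy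
    rw [Finsupp.mapDomain_id, Finsupp.mapDomain_id] at h'
    exact h'
  · rintro (rfl : μ = ν) Z f g hfg
    refine Finsupp.mapDomain_congr fun x hx => ?_
    have hx' := Finsupp.mem_support_iff.1 hx
    exact hfg x x hx' hx' rfl

theorem exists_mapDomain_subtypeVal_eq {X : Type u} (μ : X →₀ M) :
    ∃ μ' : {x // μ x ≠ 0} →₀ M, Finsupp.mapDomain Subtype.val μ' = μ := by
  refine ⟨μ.comapDomain Subtype.val Subtype.val_injective.injOn,
    Finsupp.mapDomain_comapDomain _ Subtype.val_injective _ fun x hx => ?_⟩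
  exact ⟨⟨x, Finsupp.mem_support_iff.1 hx⟩, rfl⟩

/-- Every normal lax extension lies below the relator given by `SumsAgree`. -/
theorem le_sumsAgreeRelator {L : Relator (monoidValuedFunctor M)} (hL : L.IsLaxExtension)
    (hN : L.IsNormal) : L ≤ sumsAgreeRelator M := by
  rintro X Y r ⟨μ, ν⟩ h Z f g hfg
  obtain ⟨μ', hμ⟩ := exists_mapDomain_subtypeVal_eq (M := M) μ
  obtain ⟨ν', hν⟩ := exists_mapDomain_subtypeVal_eq (M := M) ν
  -- Pulling back along the support inclusions means `f` and `g` need only agree on related support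
  -- points.
  have hmem := hL.mem_preimage (i := Subtype.val) (j := Subtype.val) (a := μ') (b := ν') (r := r)
    (show (Finsupp.mapDomain Subtype.val μ', Finsupp.mapDomain Subtype.val ν') ∈ L.onRel r by
      rw [hμ, hν]; exact h)
  have heq : Finsupp.mapDomain (f ∘ Subtype.val) μ' = Finsupp.mapDomain (g ∘ Subtype.val) ν' :=
    hL.map_eq_of_mem hN (fun x y hxy => hfg x y x.2 y.2 hxy) hmem
  rw [Finsupp.mapDomain_comp, Finsupp.mapDomain_comp, hμ, hν] at heq
  exact heq

end MonoidValued

theorem mainTheorem12 (M : Type u) [AddCommMonoid M] :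
    (∃ R : Relator (monoidValuedFunctor M), R.IsGreatestNormalLaxExtension) ↔
      IsPositiveMonoid M :=
  ⟨fun ⟨_, hR, _⟩ => isPositiveMonoid_of_isNormal hR.1 hR.2, fun hM =>
    ⟨sumsAgreeRelator M, ⟨sumsAgreeRelator_isLaxExtension hM, sumsAgreeRelator_isNormal⟩,
      fun _ hL => le_sumsAgreeRelator hL.1 hL.2⟩⟩
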